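/- For a subset $K$ of a real Banach space $X$ and $n\in\mathbb N$, let $d_n(K)_X=\inf_{W}\sup_{x\in K}\inf_{\xi\in W}\|x-\xi\|_X$ denote the affine Kolmogorov $n$-width of $K$, where $W$ runs over all (nonempty) affine subspaces of $X$ of dimension at most $n$. Let $a,L>0$. Consider the simply supported Euler–Bernoulli beam $w_{tt}+a^2w_{zzzz}=u(t)\,\partial_z\bigl(\chi_{[z_1,z_2]}(z)\,w_z\bigr)$ on $(0,L)$, $w=w_{zz}=0$ at $z=0$ and $z=L$, controlled by a contraction force on the whole beam, $[z_1,z_2]=[0,L]$. For $n,j=1,2,\dots$ put $$\omega_n=a\Bigl(\frac{\pi n}{L}\Bigr)^2,\qquad \varphi_n(z)=\sqrt{\tfrac2L}\,\sin\frac{\pi n z}{L},\qquad b_{nj}=-\frac1{\omega_j}\bigl\langle \chi_{[0,L]}\varphi_j',\varphi_n'\bigr\rangle_{L^2(0,L)} .$$ The Galerkin form of this beam is the bilinear control system $$\dot x(t)=(A+u(t)B)x(t),\qquad A=\begin{pmatrix}0&\Omega\\-\Omega&0\end{pmatrix},\quad B=\begin{pmatrix}0&0\\ b&0\end{pmatrix},\quad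 \Omega=\mathrm{diag}(\omega_1,\omega_2,\dots),\quad b=(b_{nj}),$$ on the real Hilbert space $H=\ell^2\times\ell^2$ of states $x=(\xi,\eta)$ with $\|x\|^2=\|\xi\|^2+\|\eta\|^2$, where $D(A)=\{(\xi,\eta)\in H:\sum_n\omega_n^2(\xi_n^2+\eta_n^2)<\infty\}$ and $A$ generates the group $e^{tA}$ that acts on each pair $(\xi_n,\eta_n)$ by the matrix $\begin{pmatrix}\cos\omega_nt&\sin\omega_nt\\-\sin\omega_nt&\cos\omega_nt\end{pmatrix}$. Let $T>0$ and let $K\subset L^2(0,T)$ be a nonempty set of (real) controls such that $\|u\|_{L^2(0,T)}\le r$ for all $u\in K$, where $r\ge 0$ and $T<(a/r)^2$ (no restriction on $T$ if $r=0$). For $x_0\in H$ let $\mathcal R_T(x_0)$ be the set of all values $x(T)$, where $u\in K$ and $x\in C([0,T];H)$ is the mild solution with initial state $x_0$ and control $u$, that is, $$x(t)=e^{tA}x_0+\int_0^t u(s)\,e^{(t-s)A}Bx(s)\,ds,\qquad t\in[0,T].$$ Then, for every $x_0\in H$ and every $n\in\mathbb N$, $$d_n(\mathcal R_T(x_0))_H\;\le\;\frac{\|x_0\|\sqrt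 T}{a}\,d_n(K)_{L^2(0,T)}+\frac{\|x_0\|\,T\,r^2}{a\,(a-\sqrt T\,r)} .$$ -/

import Mathlib

open MeasureTheory Filter Topology
open scoped ENNReal

noncomputable section

namespace Beam

/-! ### Affine Kolmogorov width -/

/-- The affine Kolmogorov `n`-width of a set `K` in a real normed space `X`, as an extended
nonnegative real: the infimum, over the nonempty affine subspaces `W` of dimension at most `n`,
of `sup_{x ∈ K} inf_{ξ ∈ W} ‖x - ξ‖`. -/
def affineWidth {X : Type*} [NormedAddCommGroup X] [NormedSpace ℝ X] (n : ℕ) (K : Set X) : ℝ≥0∞ :=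
  ⨅ (W : AffineSubspace ℝ X) (_ : (W : Set X).Nonempty) (_ : Module.rank ℝ W.direction ≤ n),
    ⨆ x ∈ K, ⨅ ξ ∈ W, ENNReal.ofReal ‖x - ξ‖

/-! ### Semigroups, bilinear control systems and their reachable sets -/

section Bilinear

variable {X : Type*} [NormedAddCommGroup X] [NormedSpace ℝ X]

/-- `S` restricted to `[0, ∞)` is a `C₀`-semigroup of bounded linear operators on `X`. -/
structure IsC0Semigroup (S : ℝ → X →L[ℝ] X) : Prop where
  zero : S 0 = ContinuousLinearMap.id ℝ X
  add : ∀ s t, 0 ≤ s → 0 ≤ t → S (s + t) = (S s).comp (S t)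
  strong : ∀ x, Tendsto (fun t => S t x) (𝓝[>] 0) (𝓝 x)

/-- `A` (with its domain) is the infinitesimal generator of `S`. -/
def IsGenerator (A : X →ₗ.[ℝ] X) (S : ℝ → X →L[ℝ] X) : Prop :=
  ∀ x y, (x, y) ∈ A.graph ↔ Tendsto (fun t : ℝ => t⁻¹ • (S t x - x)) (𝓝[>] 0) (𝓝 y)

/-- The real space `L²(0,T)`. -/
abbrev ControlSpace (T : ℝ) : Type := Lp ℝ 2 (volume.restrict (Set.Ioo (0 : ℝ) T))

/-- `x` is a mild solution on `[0,T]` of `x' = (A + u(t) B) x`, `x(0) = x₀`, where `A` generates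
the semigroup `S`: it is continuous and satisfies the variation of constants formula. -/
structure IsMildSolution (S : ℝ → X →L[ℝ] X) (B : X →L[ℝ] X) {T : ℝ} (u : ControlSpace T)
    (x₀ : X) (x : ℝ → X) : Prop where
  continuousOn : ContinuousOn x (Set.Icc 0 T)
  duhamel : ∀ t ∈ Set.Icc 0 T, x t = S t x₀ + ∫ s in (0 : ℝ)..t, u s • S (t - s) (B (x s))

/-- The set of the states `x(T)` that are reached at time `T` from `x₀` with controls from `K`. -/
def reachableSet (S : ℝ → X →L[ℝ] X) (B : X →L[ℝ] X) (T : ℝ) (K : Set (ControlSpace T))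
    (x₀ : X) : Set X :=
  {y | ∃ u ∈ K, ∃ x : ℝ → X, IsMildSolution S B u x₀ x ∧ x T = y}

end Bilinear

/-! ### The data of the beam -/

/-- The frequencies `ω_n = a (π n / L)²`. -/
def omega (a L : ℝ) (n : ℕ+) : ℝ := a * (Real.pi * n / L) ^ 2

/-- The normalized eigenfunctions `φ_n(z) = √(2/L) sin (π n z / L)`. -/
def phi (L : ℝ) (n : ℕ+) (z : ℝ) : ℝ := √(2 / L) * Real.sin (Real.pi * n * z / L)

/-- The coefficients `b_{nj} = -⟨χ_{[z₁,z₂]} φ_j', φ_n'⟩_{L²(0,L)} / ω_j`. -/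
def bCoeff (a L z₁ z₂ : ℝ) (n j : ℕ+) : ℝ :=
  -(1 / omega a L j) *
    ∫ z in Set.Ioo 0 L, (Set.Icc z₁ z₂).indicator 1 z * deriv (phi L j) z * deriv (phi L n) z

/-- The product of an infinite matrix and an infinite vector. -/
def matVec (M : ℕ+ → ℕ+ → ℝ) (ξ : ℕ+ → ℝ) : ℕ+ → ℝ := fun n => ∑' j, M n j * ξ j

/-- The real Hilbert space `ℓ²` of sequences indexed by the positive integers. -/
abbrev EllTwo : Type := lp (fun _ : ℕ+ => ℝ) 2

/-- The real Hilbert space `H = ℓ² × ℓ²` with the norm `‖(ξ,η)‖² = ‖ξ‖² + ‖η‖²`. -/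
abbrev H : Type := WithLp 2 (EllTwo × EllTwo)

/-! Elementary facts on `ℓ²`. -/

theorem le_of_sq_le {x y : ℝ} (h : x ^ 2 ≤ y ^ 2) (hy : 0 ≤ y) : x ≤ y :=
  (abs_le_of_sq_le_sq' h hy).2

/-- A square summable sequence, as an element of `ℓ²`. -/
def mkEll (f : ℕ+ → ℝ) (hf : Memℓp f 2) : EllTwo := ⟨f, hf⟩

@[simp] theorem mkEll_apply (f : ℕ+ → ℝ) (hf : Memℓp f 2) (n : ℕ+) : mkEll f hf n = f n := rfl

theorem memℓp_iff (f : ℕ+ → ℝ) : Memℓp f 2 ↔ Summable fun n => f n ^ 2 := by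
  rw [memℓp_gen_iff (by norm_num)]
  simp

theorem summable_sq (f : EllTwo) : Summable fun n => f n ^ 2 := (memℓp_iff _).1 (lp.memℓp f)

theorem norm_sq_eq (f : EllTwo) : ‖f‖ ^ 2 = ∑' n, f n ^ 2 := by
  have := lp.norm_rpow_eq_tsum (p := 2) (by norm_num) f
  simpa using this

theorem memℓp_mul {c : ℕ+ → ℝ} {C : ℝ} (hc : ∀ n, |c n| ≤ C) (f : EllTwo) :
    Memℓp (fun n => c n * f n) 2 := by
  rw [memℓp_iff]
  refine Summable.of_nonneg_of_le (fun n => sq_nonneg _) (fun n => ?_)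
    ((summable_sq f).mul_left (C ^ 2))
  rw [mul_pow]
  exact mul_le_mul_of_nonneg_right (sq_le_sq' (abs_le.1 (hc n)).1 (abs_le.1 (hc n)).2)
    (sq_nonneg _)

theorem norm_le_of_sq {f g : EllTwo} {C : ℝ} (hC : 0 ≤ C) (h : ∀ n, |f n| ≤ C * |g n|) :
    ‖f‖ ≤ C * ‖g‖ := by
  refine le_of_sq_le ?_ (by positivity)
  rw [mul_pow, norm_sq_eq, norm_sq_eq, ← tsum_mul_left]
  refine (summable_sq f).tsum_le_tsum (fun n => ?_) ((summable_sq g).mul_left _)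
  rw [← sq_abs (f n), ← sq_abs (g n), ← mul_pow]
  exact pow_le_pow_left₀ (abs_nonneg _) (h n) 2

/-- Multiplication by a bounded sequence, as a bounded operator on `ℓ²`. -/
def diagOp (c : ℕ+ → ℝ) (hc : ∀ n, |c n| ≤ 1) : EllTwo →L[ℝ] EllTwo :=
  LinearMap.mkContinuous
    { toFun := fun f => mkEll (fun n => c n * f n) (memℓp_mul hc f)
      map_add' := fun f g => by ext n; simp [mul_add]
      map_smul' := fun k f => by ext n; simp [mul_left_comm] }
    1 (fun f => norm_le_of_sq zero_le_one fun n => by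
      simpa [abs_mul] using mul_le_mul_of_nonneg_right (hc n) (abs_nonneg (f n)))

/-- The operator `A = [0, Ω; -Ω, 0]`, `Ω = diag (ω_n)`, with its domain
`{(ξ, η) | ∑ ω_n² (ξ_n² + η_n²) < ∞}`. -/
def beamA (a L : ℝ) : H →ₗ.[ℝ] H where
  domain :=
    { carrier := {x | Summable fun n => omega a L n ^ 2 * (x.fst n ^ 2 + x.snd n ^ 2)}
      add_mem' := by
        intro x y hx hy
        refine Summable.of_nonneg_of_le (fun n => by positivity) (fun n => ?_)
          ((hx.mul_left 2).add (hy.mul_left 2))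
        simp only [WithLp.add_fst, WithLp.add_snd, lp.coeFn_add, Pi.add_apply]
        nlinarith [mul_nonneg (sq_nonneg (omega a L n)) (sq_nonneg (x.fst n - y.fst n)),
          mul_nonneg (sq_nonneg (omega a L n)) (sq_nonneg (x.snd n - y.snd n))]
      zero_mem' := by simp [summable_zero]
      smul_mem' := by
        intro c x hx
        refine (hx.mul_left (c ^ 2)).congr fun n => ?_
        simp only [WithLp.smul_fst, WithLp.smul_snd, lp.coeFn_smul, Pi.smul_apply, smul_eq_mul]
        ring }
  toFun :=
    { toFun := fun x => WithLp.toLp 2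
        (mkEll (fun n => omega a L n * x.1.snd n) ((memℓp_iff _).2 <|
            Summable.of_nonneg_of_le (fun n => sq_nonneg _) (fun n => by
              nlinarith [mul_nonneg (sq_nonneg (omega a L n)) (sq_nonneg (x.1.fst n))]) x.2),
          mkEll (fun n => -(omega a L n * x.1.fst n)) ((memℓp_iff _).2 <|
            Summable.of_nonneg_of_le (fun n => sq_nonneg _) (fun n => by
              nlinarith [mul_nonneg (sq_nonneg (omega a L n)) (sq_nonneg (x.1.snd n))]) x.2))
      map_add' := fun x y => by
        apply WithLp.ofLp_injective
        refine Prod.ext ?_ ?_ <;> ext n <;> simp <;> ring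
      map_smul' := fun c x => by
        apply WithLp.ofLp_injective
        refine Prod.ext ?_ ?_ <;> ext n <;> simp <;> ring }

/-- The operators `e^{tA}`: on the `n`-th coordinates `(ξ_n, η_n)` they act by the matrix
`[cos ω_n t, sin ω_n t; -sin ω_n t, cos ω_n t]`. -/
def beamGroup (a L t : ℝ) : H →L[ℝ] H :=
  let e := WithLp.prodContinuousLinearEquiv 2 ℝ EllTwo EllTwo
  let C := diagOp (fun n => Real.cos (omega a L n * t)) fun _ => Real.abs_cos_le_one _
  let S := diagOp (fun n => Real.sin (omega a L n * t)) fun _ => Real.abs_sin_le_one _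
  let p := ContinuousLinearMap.fst ℝ EllTwo EllTwo
  let q := ContinuousLinearMap.snd ℝ EllTwo EllTwo
  (e.symm : EllTwo × EllTwo →L[ℝ] H) ∘L
    ((C ∘L p + S ∘L q).prod (C ∘L q - S ∘L p)) ∘L (e : H →L[ℝ] EllTwo × EllTwo)

@[simp] theorem beamGroup_fst (a L t : ℝ) (x : H) (n : ℕ+) : (beamGroup a L t x).fst n =
    Real.cos (omega a L n * t) * x.fst n + Real.sin (omega a L n * t) * x.snd n := rfl

@[simp] theorem beamGroup_snd (a L t : ℝ) (x : H) (n : ℕ+) : (beamGroup a L t x).snd n =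
    -Real.sin (omega a L n * t) * x.fst n + Real.cos (omega a L n * t) * x.snd n := by
  have : (beamGroup a L t x).snd n =
    Real.cos (omega a L n * t) * x.snd n - Real.sin (omega a L n * t) * x.fst n := rfl
  rw [this]; ring

theorem ext_coord {x y : H} (h1 : ∀ n, x.fst n = y.fst n) (h2 : ∀ n, x.snd n = y.snd n) :
    x = y := by
  apply WithLp.ofLp_injective
  refine Prod.ext ?_ ?_ <;> ext n
  exacts [h1 n, h2 n]

theorem tendsto_of_dominated {f : ℝ → EllTwo} {y : EllTwo} {l : Filter ℝ} {g : ℕ+ → ℝ}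
    (hg : Summable g) (h : ∀ n, Tendsto (fun t => f t n) l (𝓝 (y n)))
    (hb : ∀ᶠ t in l, ∀ n, (f t n - y n) ^ 2 ≤ g n) : Tendsto f l (𝓝 y) := by
  rw [tendsto_iff_norm_sub_tendsto_zero]
  have h2 : Tendsto (fun t => ∑' n, (f t n - y n) ^ 2) l (𝓝 (∑' _ : ℕ+, (0 : ℝ))) := by
    refine tendsto_tsum_of_dominated_convergence hg (fun n => ?_) ?_
    · simpa using ((h n).sub_const (y n)).pow 2
    · filter_upwards [hb] with t ht n
      simpa using ht n
  have h3 : Tendsto (fun t => ‖f t - y‖ ^ 2) l (𝓝 0) := by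
    simpa [norm_sq_eq] using h2
  simpa [Real.sqrt_sq] using h3.sqrt

theorem tendsto_H {f : ℝ → H} {y : H} {l : Filter ℝ} (h1 : Tendsto (fun t => (f t).fst) l (𝓝 y.fst))
    (h2 : Tendsto (fun t => (f t).snd) l (𝓝 y.snd)) : Tendsto f l (𝓝 y) := by
  have := (WithLp.prodContinuousLinearEquiv 2 ℝ EllTwo EllTwo).symm.continuous.tendsto
    (y.fst, y.snd)
  exact this.comp (h1.prodMk_nhds h2)

theorem tendsto_coord {f : ℝ → H} {y : H} {l : Filter ℝ} (h : Tendsto f l (𝓝 y)) (n : ℕ+) :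
    Tendsto (fun t => (f t).fst n) l (𝓝 (y.fst n)) ∧
      Tendsto (fun t => (f t).snd n) l (𝓝 (y.snd n)) := by
  have h' := ((WithLp.prodContinuousLinearEquiv 2 ℝ EllTwo EllTwo).continuous.tendsto y).comp h
  have hc : Continuous fun g : EllTwo => g n :=
    (continuous_apply n).comp (lp.uniformContinuous_coe (E := fun _ : ℕ+ => ℝ) (p := 2)).continuous
  exact ⟨(hc.tendsto _).comp ((continuous_fst.tendsto _).comp h'),
    (hc.tendsto _).comp ((continuous_snd.tendsto _).comp h')⟩

theorem isC0Semigroup_beamGroup (a L : ℝ) : IsC0Semigroup (beamGroup a L) where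
  zero := by
    ext1 x
    exact ext_coord (fun n => by simp) (fun n => by simp)
  add s t _ _ := by
    ext1 x
    refine ext_coord (fun n => ?_) (fun n => ?_) <;>
    · simp [mul_add, Real.cos_add, Real.sin_add]
      ring
  strong x := by
    have hs : Summable fun n => 8 * x.fst n ^ 2 + 8 * x.snd n ^ 2 :=
      ((summable_sq x.fst).mul_left 8).add ((summable_sq x.snd).mul_left 8)
    have key : ∀ c s p q : ℝ, |c| ≤ 1 → |s| ≤ 1 → (c * p + s * q - p) ^ 2 ≤ 8 * p ^ 2 + 8 * q ^ 2 := by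
      intro c s p q hc hs
      have h1 : (c - 1) ^ 2 ≤ 4 := by nlinarith [abs_le.1 hc]
      have h2 : s ^ 2 ≤ 1 := by nlinarith [abs_le.1 hs]
      nlinarith [sq_nonneg ((c - 1) * p - s * q), mul_le_mul_of_nonneg_right h1 (sq_nonneg p),
        mul_le_mul_of_nonneg_right h2 (sq_nonneg q)]
    refine tendsto_H (tendsto_of_dominated hs (fun n => ?_) (Eventually.of_forall fun t n => ?_))
      (tendsto_of_dominated hs (fun n => ?_) (Eventually.of_forall fun t n => ?_))
    · simp only [beamGroup_fst]
      refine tendsto_nhdsWithin_of_tendsto_nhds ?_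
      exact Continuous.tendsto' (by fun_prop) _ _ (by simp)
    · rw [beamGroup_fst]
      exact key _ _ _ _ (Real.abs_cos_le_one _) (Real.abs_sin_le_one _)
    · simp only [beamGroup_snd]
      refine tendsto_nhdsWithin_of_tendsto_nhds ?_
      exact Continuous.tendsto' (by fun_prop) _ _ (by simp)
    · rw [beamGroup_snd, add_comm (-Real.sin _ * _), add_comm (8 * _)]
      exact key _ _ _ _ (Real.abs_cos_le_one _) (by rw [abs_neg]; exact Real.abs_sin_le_one _)

theorem tendsto_quotients (w : ℝ) :
    Tendsto (fun t : ℝ => t⁻¹ * (Real.cos (w * t) - 1)) (𝓝[>] 0) (𝓝 0) ∧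
      Tendsto (fun t : ℝ => t⁻¹ * Real.sin (w * t)) (𝓝[>] 0) (𝓝 w) := by
  have h0 : HasDerivAt (fun t : ℝ => w * t) w 0 := by
    simpa using (hasDerivAt_id (0 : ℝ)).const_mul w
  have hc := h0.cos.tendsto_slope_zero_right
  have hs := h0.sin.tendsto_slope_zero_right
  simp only [mul_zero, Real.cos_zero, Real.sin_zero, neg_zero, zero_mul, one_mul, zero_add,
    sub_zero, smul_eq_mul] at hc hs
  exact ⟨hc, hs⟩

theorem quotient_bounds {w t : ℝ} (ht : 0 < t) :
    |t⁻¹ * (Real.cos (w * t) - 1)| ≤ |w| ∧ |t⁻¹ * Real.sin (w * t)| ≤ |w| := by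
  have hc : |Real.cos (w * t) - 1| ≤ |w * t| := by
    have := Real.abs_cos_sub_cos_le (w * t) 0
    simpa using this
  have hs : |Real.sin (w * t)| ≤ |w * t| := Real.abs_sin_le_abs
  rw [abs_mul, abs_mul, abs_of_pos (inv_pos.2 ht), inv_mul_le_iff₀ ht, inv_mul_le_iff₀ ht]
  rw [abs_mul, abs_of_pos ht] at hc hs
  constructor <;> linarith

/-- The operators `e^{tA}` above are indeed generated by `A`. -/
theorem isGenerator_beamA (a L : ℝ) : IsGenerator (beamA a L) (beamGroup a L) := by
  intro x y
  -- coordinates of the difference quotients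
  have e1 : ∀ t n, (t⁻¹ • (beamGroup a L t x - x)).fst n =
      (t⁻¹ * (Real.cos (omega a L n * t) - 1)) * x.fst n +
        (t⁻¹ * Real.sin (omega a L n * t)) * x.snd n := by
    intro t n
    simp only [WithLp.smul_fst, WithLp.sub_fst, WithLp.smul_snd, WithLp.sub_snd, lp.coeFn_smul,
      lp.coeFn_sub, Pi.smul_apply, Pi.sub_apply, smul_eq_mul, beamGroup_fst, beamGroup_snd]
    ring
  have e2 : ∀ t n, (t⁻¹ • (beamGroup a L t x - x)).snd n =
      (t⁻¹ * (Real.cos (omega a L n * t) - 1)) * x.snd n +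
        (t⁻¹ * Real.sin (omega a L n * t)) * (-x.fst n) := by
    intro t n
    simp only [WithLp.smul_fst, WithLp.sub_fst, WithLp.smul_snd, WithLp.sub_snd, lp.coeFn_smul,
      lp.coeFn_sub, Pi.smul_apply, Pi.sub_apply, smul_eq_mul, beamGroup_fst, beamGroup_snd]
    ring
  have l1 : ∀ n, Tendsto (fun t : ℝ => (t⁻¹ • (beamGroup a L t x - x)).fst n) (𝓝[>] 0)
      (𝓝 (omega a L n * x.snd n)) := by
    intro n
    simp only [e1]
    obtain ⟨hc, hs⟩ := tendsto_quotients (omega a L n)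
    simpa using (hc.mul_const (x.fst n)).add (hs.mul_const (x.snd n))
  have l2 : ∀ n, Tendsto (fun t : ℝ => (t⁻¹ • (beamGroup a L t x - x)).snd n) (𝓝[>] 0)
      (𝓝 (-(omega a L n * x.fst n))) := by
    intro n
    simp only [e2]
    obtain ⟨hc, hs⟩ := tendsto_quotients (omega a L n)
    simpa using (hc.mul_const (x.snd n)).add (hs.mul_const (-x.fst n))
  constructor
  · intro h
    obtain ⟨z, hz, hzy⟩ := (LinearPMap.mem_graph_iff _).1 h
    obtain ⟨z, hzd⟩ := z
    dsimp only at hz hzy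
    subst hz hzy
    have hd : Summable fun n => omega a L n ^ 2 * (z.fst n ^ 2 + z.snd n ^ 2) := hzd
    have key : ∀ w c s p q : ℝ, |c| ≤ |w| → |s| ≤ |w| →
        (c * p + s * q - w * q) ^ 2 ≤ 8 * (w ^ 2 * (p ^ 2 + q ^ 2)) := by
      intro w c s p q hc hs
      have h1 : c ^ 2 ≤ w ^ 2 := sq_le_sq.2 hc
      have h2 : s ^ 2 ≤ w ^ 2 := sq_le_sq.2 hs
      have h3 : (s - w) ^ 2 ≤ 4 * w ^ 2 := by nlinarith [sq_nonneg (s + w)]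
      nlinarith [sq_nonneg (c * p - (s - w) * q), mul_le_mul_of_nonneg_right h1 (sq_nonneg p),
        mul_le_mul_of_nonneg_right h3 (sq_nonneg q), mul_nonneg (sq_nonneg w) (sq_nonneg p)]
    refine tendsto_H (tendsto_of_dominated (hd.mul_left 8) l1 ?_)
      (tendsto_of_dominated (hd.mul_left 8) l2 ?_)
    · filter_upwards [self_mem_nhdsWithin] with t ht n
      rw [e1]
      obtain ⟨hc, hs⟩ := quotient_bounds (w := omega a L n) ht
      exact key _ _ _ _ _ hc hs
    · filter_upwards [self_mem_nhdsWithin] with t ht n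
      rw [e2]
      obtain ⟨hc, hs⟩ := quotient_bounds (w := omega a L n) ht
      have := key _ _ _ (z.snd n) (-z.fst n) hc hs
      rw [neg_sq, add_comm (z.snd n ^ 2), mul_neg (omega a L n)] at this
      exact this
  · intro h
    have y1 : ∀ n, y.fst n = omega a L n * x.snd n := fun n =>
      tendsto_nhds_unique (tendsto_coord h n).1 (l1 n)
    have y2 : ∀ n, y.snd n = -(omega a L n * x.fst n) := fun n =>
      tendsto_nhds_unique (tendsto_coord h n).2 (l2 n)
    have hd : x ∈ (beamA a L).domain := by
      change Summable _
      refine ((summable_sq y.fst).add (summable_sq y.snd)).congr fun n => ?_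
      rw [y1, y2]; ring
    rw [LinearPMap.mem_graph_iff]
    refine ⟨⟨x, hd⟩, rfl, ext_coord (fun n => ?_) (fun n => ?_)⟩
    · exact (y1 n).symm
    · exact (y2 n).symm

/-! The matrix `b` for a force acting on the whole beam. -/

theorem integral_cos_int {L : ℝ} (hL : 0 < L) (k : ℤ) :
    ∫ z in (0 : ℝ)..L, Real.cos (Real.pi * k / L * z) = if k = 0 then L else 0 := by
  split_ifs with hk
  · simp [hk]
  · have hne : Real.pi * k / L ≠ 0 := by
      have : (k : ℝ) ≠ 0 := by exact_mod_cast hk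
      have := Real.pi_ne_zero
      positivity
    rw [intervalIntegral.integral_comp_mul_left _ hne, integral_cos,
      div_mul_cancel₀ _ hL.ne', mul_comm Real.pi, Real.sin_int_mul_pi]
    simp

theorem deriv_phi (L : ℝ) (n : ℕ+) (z : ℝ) :
    deriv (phi L n) z = √(2 / L) * (Real.pi * n / L * Real.cos (Real.pi * n / L * z)) := by
  have h0 : HasDerivAt (fun z : ℝ => Real.pi * n * z / L) (Real.pi * n / L) z := by
    simpa using ((hasDerivAt_id z).const_mul (Real.pi * n)).div_const L
  have := (h0.sin.const_mul (√(2 / L))).deriv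
  rw [mul_comm (Real.pi * n / L : ℝ) (Real.cos _), div_mul_eq_mul_div]
  exact this

theorem bCoeff_full {a L : ℝ} (ha : 0 < a) (hL : 0 < L) (n j : ℕ+) :
    bCoeff a L 0 L n j = if n = j then -(1 / a) else 0 := by
  have h1 : ∫ z in Set.Ioo 0 L,
      (Set.Icc 0 L).indicator 1 z * deriv (phi L j) z * deriv (phi L n) z =
      ∫ z in (0 : ℝ)..L, Real.pi * n / L * (Real.pi * j / L) / L *
        (Real.cos (Real.pi * ((n - j : ℤ) : ℝ) / L * z)
          + Real.cos (Real.pi * ((n + j : ℤ) : ℝ) / L * z)) := by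
    rw [intervalIntegral.integral_of_le hL.le, integral_Ioc_eq_integral_Ioo]
    refine setIntegral_congr_fun measurableSet_Ioo fun z hz => ?_
    have hz' : z ∈ Set.Icc 0 L := ⟨hz.1.le, hz.2.le⟩
    have hsq : √(2 / L) * √(2 / L) = 2 / L := Real.mul_self_sqrt (by positivity)
    have e1 : Real.pi * ((n - j : ℤ) : ℝ) / L * z = Real.pi * n / L * z - Real.pi * j / L * z := by
      push_cast; ring
    have e2 : Real.pi * ((n + j : ℤ) : ℝ) / L * z = Real.pi * n / L * z + Real.pi * j / L * z := by
      push_cast; ring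
    simp only [Set.indicator_of_mem hz', Pi.one_apply, deriv_phi]
    rw [e1, e2, Real.cos_sub, Real.cos_add]
    calc _ = (√(2 / L) * √(2 / L)) * (Real.pi * n / L * (Real.pi * j / L)) *
          (Real.cos (Real.pi * n / L * z) * Real.cos (Real.pi * j / L * z)) := by ring
      _ = _ := by rw [hsq]; ring
  have hi : ∀ k : ℤ, IntervalIntegrable (fun z => Real.cos (Real.pi * (k : ℝ) / L * z))
      volume 0 L := fun k => Continuous.intervalIntegrable (by fun_prop) _ _
  have hs : ((n : ℤ) + j : ℤ) ≠ 0 := by have := n.pos; have := j.pos; omega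
  rw [bCoeff, h1, intervalIntegral.integral_const_mul,
    intervalIntegral.integral_add (hi _) (hi _), integral_cos_int hL, integral_cos_int hL,
    if_neg hs]
  by_cases h : n = j
  · subst h
    have := Real.pi_pos
    have hn : (0 : ℝ) < n := by exact_mod_cast n.pos
    simp only [sub_self, if_true, omega]
    field_simp
    ring
  · have hd : ((n : ℤ) - j : ℤ) ≠ 0 := by
      intro hh
      apply h
      apply PNat.coe_injective
      omega
    rw [if_neg hd, if_neg h]
    simp

theorem matVec_full {a L : ℝ} (ha : 0 < a) (hL : 0 < L) (ξ : ℕ+ → ℝ) (n : ℕ+) :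
    matVec (bCoeff a L 0 L) ξ n = -(1 / a) * ξ n := by
  rw [matVec, tsum_eq_single n]
  · rw [bCoeff_full ha hL, if_pos rfl]
  · intro j hj
    rw [bCoeff_full ha hL, if_neg hj.symm, zero_mul]

/-- The bounded operator `B = [0, 0; b, 0]` on `H`, `b = (b_{nj})`, for a force acting on the
whole beam (`[z₁, z₂] = [0, L]`). -/
def beamB (a L : ℝ) (ha : 0 < a) (hL : 0 < L) : H →L[ℝ] H :=
  LinearMap.mkContinuous
    { toFun := fun x => WithLp.toLp 2 (0, mkEll (matVec (bCoeff a L 0 L) x.fst) (by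
        rw [funext (matVec_full ha hL x.fst)]
        exact memℓp_mul (fun _ => le_rfl) x.fst))
      map_add' := fun x y => by
        refine ext_coord (fun n => by simp) (fun n => ?_)
        change matVec _ _ n = matVec _ _ n + matVec _ _ n
        simp only [matVec_full ha hL, WithLp.add_fst, lp.coeFn_add, Pi.add_apply, mul_add]
      map_smul' := fun c x => by
        refine ext_coord (fun n => by simp) (fun n => ?_)
        change matVec _ _ n = c * matVec _ _ n
        simp only [matVec_full ha hL, WithLp.smul_fst, lp.coeFn_smul, Pi.smul_apply, smul_eq_mul]
        ring }
    (1 / a) (fun x => by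
      rw [LinearMap.coe_mk, AddHom.coe_mk]
      have hb : (0 : ℝ) ≤ 1 / a := by positivity
      have hx : ‖x.fst‖ ≤ ‖x‖ := by
        refine le_of_sq_le ?_ (norm_nonneg _)
        rw [WithLp.prod_norm_sq_eq_of_L2 x]
        nlinarith [sq_nonneg ‖x.snd‖]
      refine le_trans ?_ (mul_le_mul_of_nonneg_left hx hb)
      rw [WithLp.prod_norm_eq_of_L2]
      rw [WithLp.toLp_fst, WithLp.toLp_snd, norm_zero, zero_pow two_ne_zero, zero_add,
        Real.sqrt_sq (norm_nonneg _)]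
      refine norm_le_of_sq hb fun n => ?_
      change |matVec _ _ n| ≤ _
      rw [matVec_full ha hL, abs_mul, abs_neg, abs_of_nonneg hb])

end Beam

end

/-!
The first order Volterra term
`F(u) = e^{TA} x₀ + ∫₀ᵀ u(s) e^{(T-s)A} B e^{sA} x₀ ds` is an affine map of the control. Since
`e^{tA}` is a contraction and `‖B‖ ≤ 1 / a`, the Cauchy-Schwarz inequality shows that `F` is
Lipschitz with constant `‖x₀‖ √T / a`, so that it maps an affine subspace approximating `K` to an
affine subspace, of no larger dimension, approximating `F(K)` (`affineWidth_le_of_approx`).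

It remains to compare `x(T)` with `F(u)`. Put `q = √T r / a < 1`. Every integral in question has
the form `∫₀ᵗ u(s) e^{(t-s)A} B y(s) ds`, and is at most `q sup ‖y‖` in norm
(`norm_duhamel_integral_le`). With `y = x` at a maximum point of `‖x‖` this gives
`(1 - q) sup ‖x‖ ≤ ‖x₀‖` (`IsMildSolution.norm_le`), hence
`‖x(s) - e^{sA} x₀‖ ≤ q ‖x₀‖ / (1 - q)`; with `y(s) = x(s) - e^{sA} x₀` it then gives
`‖x(T) - F(u)‖ ≤ q² ‖x₀‖ / (1 - q)`, which is the second term of the bound.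
-/

namespace Beam

/-! ### Widths and affine approximation -/

/-- If every point of `R` is within `e` of the image of a point of `K` under a `c`-Lipschitz affine
map `F`, then the width of `R` is at most `c` times the width of `K`, plus `e`. -/
theorem affineWidth_le_of_approx {X Y : Type*} [NormedAddCommGroup X] [NormedSpace ℝ X]
    [NormedAddCommGroup Y] [NormedSpace ℝ Y] (F : X →ᵃ[ℝ] Y) {c e : ℝ≥0∞} (hc : c ≠ ∞)
    (hF : ∀ u v, ENNReal.ofReal ‖F u - F v‖ ≤ c * ENNReal.ofReal ‖u - v‖) {K : Set X} {R : Set Y}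
    (hR : ∀ y ∈ R, ∃ u ∈ K, ENNReal.ofReal ‖y - F u‖ ≤ e) (n : ℕ) :
    affineWidth n R ≤ c * affineWidth n K + e := by
  let ι := {W : AffineSubspace ℝ X // (W : Set X).Nonempty ∧ Module.rank ℝ W.direction ≤ n}
  -- `ι` is nonempty because it contains a point; this matters when `c = 0`
  have : Nonempty ι := ⟨⟨AffineSubspace.mk' 0 ⊥, ⟨0, AffineSubspace.self_mem_mk' _ _⟩, by
    rw [AffineSubspace.direction_mk']; simp⟩⟩
  have hK : affineWidth n K =
      ⨅ W : ι, ⨆ x ∈ K, ⨅ ξ ∈ W.1, ENNReal.ofReal ‖x - ξ‖ := by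
    rw [affineWidth, iInf_subtype]
    simp only [iInf_and]
  rw [hK, ENNReal.mul_iInf fun h => absurd h hc, ENNReal.iInf_add]
  refine le_iInf fun ⟨W, hW, hn⟩ => ?_
  refine iInf₂_le_of_le (W.map F) (hW.image F) (iInf_le_of_le ?_ ?_)
  · rw [AffineSubspace.map_direction]
    have h := lift_rank_map_le F.linear W.direction
    rw [← Cardinal.lift_le_nat_iff] at hn ⊢
    exact h.trans hn
  refine iSup₂_le fun y hy => ?_
  obtain ⟨u, hu, hy⟩ := hR y hy
  have : Nonempty W := hW.to_subtype
  calc ⨅ ξ ∈ W.map F, ENNReal.ofReal ‖y - ξ‖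
      ≤ ⨅ ζ : W, (c * ENNReal.ofReal ‖u - ζ‖ + e) := by
        refine le_iInf fun ζ => iInf₂_le_of_le (F ζ) (Set.mem_image_of_mem F ζ.2) ?_
        have h : ‖y - F ζ‖ ≤ ‖F u - F ζ‖ + ‖y - F u‖ := by
          rw [add_comm]; exact norm_sub_le_norm_sub_add_norm_sub _ _ _
        refine (ENNReal.ofReal_le_ofReal h).trans ?_
        rw [ENNReal.ofReal_add (norm_nonneg _) (norm_nonneg _)]
        exact add_le_add (hF _ _) hy
    _ = c * (⨅ ξ ∈ W, ENNReal.ofReal ‖u - ξ‖) + e := by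
        rw [← ENNReal.iInf_add, ← ENNReal.mul_iInf fun h => absurd h hc]
        congr 2
        exact iInf_subtype
    _ ≤ _ := by
        gcongr
        exact le_iSup₂_of_le (f := fun x (_ : x ∈ K) => ⨅ ξ ∈ W, ENNReal.ofReal ‖x - ξ‖) u hu le_rfl

/-! ### Integrals against square integrable controls -/

section Bilinear

variable {X : Type*} [NormedAddCommGroup X] [NormedSpace ℝ X]

theorem ControlSpace.integrable {T : ℝ} (u : ControlSpace T) :
    Integrable u (volume.restrict (Set.Ioo 0 T)) :=
  (Lp.memLp u).integrable one_le_two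

theorem ControlSpace.intervalIntegrable {T t : ℝ} (u : ControlSpace T) (ht : t ∈ Set.Icc 0 T) :
    IntervalIntegrable u volume 0 t := by
  rw [intervalIntegrable_iff_integrableOn_Ioo_of_le ht.1]
  exact IntegrableOn.mono_set (t := Set.Ioo 0 T) u.integrable (Set.Ioo_subset_Ioo_right ht.2)

/-- The Cauchy-Schwarz inequality `‖u‖_{L¹(0,T)} ≤ √T ‖u‖_{L²(0,T)}`. -/
theorem ControlSpace.integral_norm_le {T : ℝ} (hT : 0 ≤ T) (u : ControlSpace T) :
    ∫ s in Set.Ioo 0 T, ‖u s‖ ≤ √T * ‖u‖ := by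
  have h := eLpNorm_le_eLpNorm_mul_rpow_measure_univ (p := 1) (q := 2) one_le_two
    (Lp.memLp u).aestronglyMeasurable
  have h1 : ∫ s in Set.Ioo 0 T, ‖u s‖ =
      (eLpNorm u 1 (volume.restrict (Set.Ioo 0 T))).toReal := by
    rw [integral_norm_eq_lintegral_enorm (Lp.memLp u).aestronglyMeasurable,
      eLpNorm_one_eq_lintegral_enorm]
  rw [h1, Lp.norm_def, mul_comm, Real.sqrt_eq_rpow]
  refine (ENNReal.toReal_mono ?_ h).trans_eq ?_
  · exact ENNReal.mul_ne_top (Lp.memLp u).2.ne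
      (ENNReal.rpow_ne_top_of_nonneg (by norm_num) (measure_ne_top _ _))
  · rw [ENNReal.toReal_mul, ← ENNReal.toReal_rpow]
    have he : (1 : ℝ) / ENNReal.toReal 1 - 1 / ENNReal.toReal 2 = 1 / 2 := by norm_num
    rw [he, Measure.restrict_apply_univ, Real.volume_Ioo, sub_zero, ENNReal.toReal_ofReal hT]

theorem ControlSpace.norm_integral_smul_le {T t M : ℝ} (u : ControlSpace T)
    (ht : t ∈ Set.Icc 0 T) {f : ℝ → X} (hf : ∀ s ∈ Set.Icc 0 t, ‖f s‖ ≤ M) :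
    ‖∫ s in (0 : ℝ)..t, u s • f s‖ ≤ √T * ‖u‖ * M := by
  have hM : 0 ≤ M := (norm_nonneg _).trans (hf 0 ⟨le_rfl, ht.1⟩)
  calc ‖∫ s in (0 : ℝ)..t, u s • f s‖ ≤ ∫ s in (0 : ℝ)..t, ‖u s‖ * M := by
        refine intervalIntegral.norm_integral_le_of_norm_le ht.1 (ae_of_all _ fun s hs => ?_)
          ((u.intervalIntegrable ht).norm.mul_const M)
        rw [norm_smul]
        exact mul_le_mul_of_nonneg_left (hf s ⟨hs.1.le, hs.2⟩) (norm_nonneg _)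
    _ = (∫ s in Set.Ioo 0 t, ‖u s‖) * M := by
        rw [intervalIntegral.integral_mul_const, intervalIntegral.integral_of_le ht.1,
          integral_Ioc_eq_integral_Ioo]
    _ ≤ √T * ‖u‖ * M := by
        refine mul_le_mul_of_nonneg_right (le_trans ?_ (u.integral_norm_le (ht.1.trans ht.2))) hM
        exact setIntegral_mono_set (t := Set.Ioo 0 T) u.integrable.norm
          (ae_of_all _ fun _ => norm_nonneg _) (Set.Ioo_subset_Ioo_right ht.2).eventuallyLE

theorem ControlSpace.intervalIntegrable_smul {T : ℝ} (hT : 0 ≤ T) (u : ControlSpace T)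
    {f : ℝ → X} (hf : ContinuousOn f (Set.Icc 0 T)) :
    IntervalIntegrable (fun s => u s • f s) volume 0 T :=
  (u.intervalIntegrable ⟨hT, le_rfl⟩).smul_continuousOn (by rwa [Set.uIcc_of_le hT])

/-- The linear map `u ↦ ∫₀ᵀ u(s) f(s) ds` on `L²(0,T)`, for a continuous function `f`. -/
noncomputable def controlIntegral {T : ℝ} (hT : 0 ≤ T) (f : ℝ → X) (hf : ContinuousOn f (Set.Icc 0 T)) :
    ControlSpace T →ₗ[ℝ] X where
  toFun u := ∫ s in (0 : ℝ)..T, u s • f s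
  map_add' u v := by
    rw [← intervalIntegral.integral_add (u.intervalIntegrable_smul hT hf)
      (v.intervalIntegrable_smul hT hf)]
    simp only [intervalIntegral.integral_of_le hT, integral_Ioc_eq_integral_Ioo]
    refine integral_congr_ae ?_
    filter_upwards [Lp.coeFn_add u v] with s hs
    rw [hs, Pi.add_apply, add_smul]
  map_smul' k u := by
    rw [RingHom.id_apply, ← intervalIntegral.integral_smul]
    simp only [intervalIntegral.integral_of_le hT, integral_Ioc_eq_integral_Ioo]
    refine integral_congr_ae ?_
    filter_upwards [Lp.coeFn_smul k u] with s hs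
    rw [hs, Pi.smul_apply, smul_assoc]

/-! ### Mild solutions for contraction semigroups -/

variable {S : ℝ → X →L[ℝ] X} {B : X →L[ℝ] X} {T β : ℝ} {u : ControlSpace T} {x₀ : X} {x : ℝ → X}

theorem norm_comp_le (hS : ∀ t x, ‖S t x‖ ≤ ‖x‖) (hB : ‖B‖ ≤ β) {t C : ℝ} {y : X} (hy : ‖y‖ ≤ C) :
    ‖S t (B y)‖ ≤ β * C :=
  (hS t _).trans (B.le_of_opNorm_le_of_le hB hy)

theorem norm_duhamel_integral_le (hS : ∀ t x, ‖S t x‖ ≤ ‖x‖) (hB : ‖B‖ ≤ β) (u : ControlSpace T)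
    {t C : ℝ} (ht : t ∈ Set.Icc 0 T) {y : ℝ → X} (hy : ∀ s ∈ Set.Icc 0 T, ‖y s‖ ≤ C) :
    ‖∫ s in (0 : ℝ)..t, u s • S (t - s) (B (y s))‖ ≤ √T * ‖u‖ * (β * C) :=
  u.norm_integral_smul_le ht fun s hs => norm_comp_le hS hB (hy s ⟨hs.1, hs.2.trans ht.2⟩)

theorem continuousOn_duhamel_kernel (hc : Continuous fun p : ℝ × X => S p.1 p.2) {y : ℝ → X}
    {s : Set ℝ} (hy : ContinuousOn y s) (t : ℝ) : ContinuousOn (fun s => S (t - s) (B (y s))) s :=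
  hc.comp_continuousOn ((continuousOn_const.sub continuousOn_id).prodMk
    (B.continuous.comp_continuousOn hy))

theorem IsMildSolution.norm_le (hx : IsMildSolution S B u x₀ x) (hS : ∀ t x, ‖S t x‖ ≤ ‖x‖)
    (hB : ‖B‖ ≤ β) {q : ℝ} (hu : √T * ‖u‖ * β ≤ q) (hq : q < 1) {t : ℝ} (ht : t ∈ Set.Icc 0 T) :
    ‖x t‖ ≤ ‖x₀‖ / (1 - q) := by
  obtain ⟨m, hm, hmax⟩ := isCompact_Icc.exists_isMaxOn ⟨t, ht⟩ hx.continuousOn.norm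
  have h1 : ‖x m‖ ≤ ‖x₀‖ + √T * ‖u‖ * (β * ‖x m‖) := by
    conv_lhs => rw [hx.duhamel m hm]
    exact (norm_add_le _ _).trans
      (add_le_add (hS _ _) (norm_duhamel_integral_le hS hB u hm fun s hs => hmax hs))
  have h2 := mul_le_mul_of_nonneg_right hu (norm_nonneg (x m))
  refine (hmax ht : ‖x t‖ ≤ ‖x m‖).trans ?_
  rw [le_div_iff₀ (by linarith)]
  linarith

theorem IsMildSolution.norm_sub_le (hx : IsMildSolution S B u x₀ x) (hS : ∀ t x, ‖S t x‖ ≤ ‖x‖)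
    (hB : ‖B‖ ≤ β) {q : ℝ} (hu : √T * ‖u‖ * β ≤ q) (hq : q < 1) {t : ℝ} (ht : t ∈ Set.Icc 0 T) :
    ‖x t - S t x₀‖ ≤ q * (‖x₀‖ / (1 - q)) := by
  rw [hx.duhamel t ht, add_sub_cancel_left]
  refine (norm_duhamel_integral_le hS hB u ht fun s hs => hx.norm_le hS hB hu hq hs).trans ?_
  rw [← mul_assoc]
  exact mul_le_mul_of_nonneg_right hu (div_nonneg (norm_nonneg _) (by linarith))

/-- The distance of a mild solution at time `T` from its first order Volterra approximation. -/
theorem IsMildSolution.norm_sub_firstOrder_le (hx : IsMildSolution S B u x₀ x)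
    (hS : ∀ t x, ‖S t x‖ ≤ ‖x‖) (hc : Continuous fun p : ℝ × X => S p.1 p.2) (hB : ‖B‖ ≤ β)
    {q : ℝ} (hu : √T * ‖u‖ * β ≤ q) (hq : q < 1) (hT : 0 ≤ T) :
    ‖x T - (S T x₀ + ∫ s in (0 : ℝ)..T, u s • S (T - s) (B (S s x₀)))‖ ≤
      q * (q * (‖x₀‖ / (1 - q))) := by
  have hTm : T ∈ Set.Icc 0 T := ⟨hT, le_rfl⟩
  have hq0 : 0 ≤ q := le_trans (by have := (norm_nonneg B).trans hB; positivity) hu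
  have hS₀ : Continuous fun s => S s x₀ := hc.comp (continuous_id.prodMk continuous_const)
  rw [hx.duhamel T hTm, add_sub_add_left_eq_sub, ← intervalIntegral.integral_sub
    (u.intervalIntegrable_smul hT (continuousOn_duhamel_kernel hc hx.continuousOn T))
    (u.intervalIntegrable_smul hT (continuousOn_duhamel_kernel hc hS₀.continuousOn T))]
  simp only [← smul_sub, ← map_sub]
  refine (norm_duhamel_integral_le hS hB u hTm fun s hs => hx.norm_sub_le hS hB hu hq hs).trans ?_
  rw [← mul_assoc]
  exact mul_le_mul_of_nonneg_right hu
    (mul_nonneg hq0 (div_nonneg (norm_nonneg _) (by linarith)))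

/-- The width estimate for a bilinear system whose free dynamics is a contraction semigroup;
`q` is the contraction constant of the Volterra equation. -/
theorem affineWidth_reachableSet_le (hS : ∀ t x, ‖S t x‖ ≤ ‖x‖)
    (hc : Continuous fun p : ℝ × X => S p.1 p.2) (hB : ‖B‖ ≤ β) (hT : 0 ≤ T)
    {K : Set (ControlSpace T)} {q : ℝ} (hK : ∀ u ∈ K, √T * ‖u‖ * β ≤ q) (hq : q < 1)
    (x₀ : X) (n : ℕ) :
    affineWidth n (reachableSet S B T K x₀) ≤
      ENNReal.ofReal (√T * (β * ‖x₀‖)) * affineWidth n K +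
        ENNReal.ofReal (q * (q * (‖x₀‖ / (1 - q)))) := by
  have hS₀ : Continuous fun s => S s x₀ := hc.comp (continuous_id.prodMk continuous_const)
  have hTm : T ∈ Set.Icc 0 T := ⟨hT, le_rfl⟩
  have hβ : 0 ≤ β := (norm_nonneg B).trans hB
  let G := controlIntegral hT (fun s => S (T - s) (B (S s x₀)))
    (continuousOn_duhamel_kernel hc hS₀.continuousOn T)
  let F : ControlSpace T →ᵃ[ℝ] X := AffineMap.const ℝ _ (S T x₀) + G.toAffineMap
  have hF : ∀ u, F u = S T x₀ + ∫ s in (0 : ℝ)..T, u s • S (T - s) (B (S s x₀)) := fun _ => rfl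
  refine affineWidth_le_of_approx F ENNReal.ofReal_ne_top (fun u v => ?_) ?_ n
  · rw [← ENNReal.ofReal_mul (by positivity)]
    refine ENNReal.ofReal_le_ofReal ?_
    have h : F u - F v = G (u - v) := by
      rw [map_sub]; exact add_sub_add_left_eq_sub _ _ _
    rw [h, mul_right_comm]
    exact norm_duhamel_integral_le hS hB (u - v) hTm fun s _ => hS s x₀
  · rintro _ ⟨u, hu, x, hx, rfl⟩
    refine ⟨u, hu, ENNReal.ofReal_le_ofReal ?_⟩
    rw [hF]
    exact hx.norm_sub_firstOrder_le hS hc hB (hK u hu) hq hT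

end Bilinear

/-! ### The operators of the beam -/

theorem norm_sq_eq_tsum (x : H) : ‖x‖ ^ 2 = ∑' n, (x.fst n ^ 2 + x.snd n ^ 2) := by
  rw [WithLp.prod_norm_sq_eq_of_L2, norm_sq_eq, norm_sq_eq,
    (summable_sq x.fst).tsum_add (summable_sq x.snd)]

theorem norm_beamGroup (a L t : ℝ) (x : H) : ‖beamGroup a L t x‖ = ‖x‖ := by
  rw [← sq_eq_sq₀ (norm_nonneg _) (norm_nonneg _), norm_sq_eq_tsum, norm_sq_eq_tsum]
  refine tsum_congr fun n => ?_
  rw [beamGroup_fst, beamGroup_snd]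
  linear_combination (x.fst n ^ 2 + x.snd n ^ 2) * Real.sin_sq_add_cos_sq (omega a L n * t)

theorem beamGroup_add (a L s t : ℝ) (x : H) :
    beamGroup a L (s + t) x = beamGroup a L s (beamGroup a L t x) := by
  refine ext_coord (fun n => ?_) (fun n => ?_) <;>
  · simp only [beamGroup_fst, beamGroup_snd, mul_add, Real.cos_add, Real.sin_add]
    ring

/-- The operators `e^{tA}` form a group of isometries, so that their strong continuity from the
right at `0` gives strong continuity at all times. -/
theorem continuous_beamGroup_apply (a L : ℝ) (x : H) : Continuous fun t => beamGroup a L t x := by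
  have h0 := (isC0Semigroup_beamGroup a L).strong x
  have hz : beamGroup a L 0 x = x := by rw [(isC0Semigroup_beamGroup a L).zero]; rfl
  -- `‖e^{tA} x - e^{sA} x‖ = ‖e^{|t - s|A} x - x‖`
  have hd : ∀ s t, ‖beamGroup a L t x - beamGroup a L s x‖ = ‖beamGroup a L |t - s| x - x‖ := by
    have key : ∀ s t, s ≤ t →
        ‖beamGroup a L t x - beamGroup a L s x‖ = ‖beamGroup a L |t - s| x - x‖ := by
      intro s t h
      rw [abs_of_nonneg (sub_nonneg.2 h), ← norm_beamGroup a L s (_ - x), map_sub,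
        ← beamGroup_add, add_sub_cancel]
    intro s t
    rcases le_total s t with h | h
    · exact key s t h
    · rw [norm_sub_rev, abs_sub_comm, key t s h]
  have h1 : Tendsto (fun t => beamGroup a L t x) (𝓝[≥] 0) (𝓝 x) := by
    rw [← Set.Ioi_insert, nhdsWithin_insert]
    refine tendsto_sup.2 ⟨?_, h0⟩
    rw [tendsto_pure_left]
    intro s hs
    rw [hz]
    exact mem_of_mem_nhds hs
  rw [continuous_iff_continuousAt]
  intro s
  rw [ContinuousAt, tendsto_iff_norm_sub_tendsto_zero]
  simp only [hd]
  have h2 : Tendsto (fun t : ℝ => |t - s|) (𝓝 s) (𝓝[≥] 0) :=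
    tendsto_nhdsWithin_iff.2
      ⟨Continuous.tendsto' (by fun_prop) _ _ (by simp), Eventually.of_forall fun t => Set.mem_Ici.2 (abs_nonneg _)⟩
  exact tendsto_iff_norm_sub_tendsto_zero.1 (h1.comp h2)

theorem continuous_beamGroup (a L : ℝ) : Continuous fun p : ℝ × H => beamGroup a L p.1 p.2 :=
  continuous_prod_of_continuous_lipschitzWith' _ 1
    (fun t => LipschitzWith.of_dist_le_mul fun x y => by
      simp [dist_eq_norm, ← map_sub, norm_beamGroup])
    (fun x => continuous_beamGroup_apply a L x)

theorem norm_beamB_le (a L : ℝ) (ha : 0 < a) (hL : 0 < L) : ‖beamB a L ha hL‖ ≤ 1 / a :=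
  LinearMap.mkContinuous_norm_le _ (by positivity) _

end Beam

/-- Width estimate for the reachable sets of the Galerkin form of the simply supported
Euler-Bernoulli beam, controlled by a contraction force on the whole beam. -/
theorem corollary1 (a L T r : ℝ) (ha : 0 < a) (hL : 0 < L) (hT : 0 < T)
    (K : Set (Beam.ControlSpace T)) (hK : K.Nonempty) (hKr : ∀ u ∈ K, ‖u‖ ≤ r)
    (hTr : 0 < r → T < (a / r) ^ 2) (x₀ : Beam.H) (n : ℕ) :
    Beam.affineWidth n
        (Beam.reachableSet (Beam.beamGroup a L) (Beam.beamB a L ha hL) T K x₀) ≤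
      ENNReal.ofReal (‖x₀‖ * √T / a) * Beam.affineWidth n K +
        ENNReal.ofReal (‖x₀‖ * T * r ^ 2 / (a * (a - √T * r))) := by
  obtain ⟨v, hv⟩ := hK
  have hr : 0 ≤ r := (norm_nonneg v).trans (hKr v hv)
  have hlt : √T * r < a := by
    rcases hr.eq_or_lt with rfl | hr'
    · simpa using ha
    · rw [← lt_div_iff₀ hr']
      exact (Real.sqrt_lt' (by positivity)).2 (hTr hr')
  have hq : √T * r * (1 / a) < 1 := by
    rw [mul_one_div, div_lt_one ha]
    exact hlt
  have h := Beam.affineWidth_reachableSet_le (fun t x => (Beam.norm_beamGroup a L t x).le)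
    (Beam.continuous_beamGroup a L) (Beam.norm_beamB_le a L ha hL) hT.le (K := K)
    (fun u hu => by
      have := hKr u hu
      gcongr) hq x₀ n
  have hne : a - √T * r ≠ 0 := by linarith
  have e1 : √T * (1 / a * ‖x₀‖) = ‖x₀‖ * √T / a := by ring
  have e2 : √T * r * (1 / a) * (√T * r * (1 / a) * (‖x₀‖ / (1 - √T * r * (1 / a)))) =
      ‖x₀‖ * T * r ^ 2 / (a * (a - √T * r)) := by
    have e3 : 1 - √T * r * (1 / a) = (a - √T * r) / a := by field_simp
    rw [e3]
    field_simp
    rw [Real.sq_sqrt hT.le]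
    ring
  rwa [e1, e2] at h
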